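/- Let $p$ be a prime and let $k \ge 2$ be an integer with $k \mid p-1$. An element $a \in \mathbb{F}_p$ is called a $k$-th power non-residue if there is no $y \in \mathbb{F}_p$ with $y^k = a$. Let $b \ge 1$ and $c$ be integers with $p \nmid b$. Then the arithmetic progression $\{bn+c\}_{n=0,1,2,\ldots}$ contains an integer whose class modulo $p$ is a $k$-th power non-residue, and the least such integer $v$ satisfies $$v \;\le\; \frac{7}{\sqrt5}\, b\, \sqrt{\frac{p-1}{k}} + 4b + c .$$ -/

import Mathlib

/-- An element `a` of the prime field `𝔽_p` is a `k`-th power non-residue if there is no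
`y ∈ 𝔽_p` with `y ^ k = a`. In particular `0` is not a non-residue when `k ≥ 1`. -/
def IsPowerNonResidue (p k : ℕ) (a : ZMod p) : Prop :=
  ¬ ∃ y : ZMod p, y ^ k = a

/-- The integers in the arithmetic progression `{b n + c}`, `n = 0, 1, 2, …`, whose class modulo
`p` is a `k`-th power non-residue. -/
def nonResiduesInAP (p k b : ℕ) (c : ℤ) : Set ℤ :=
  {v | ∃ n : ℕ, v = (b : ℤ) * (n : ℤ) + c ∧ IsPowerNonResidue p k (v : ZMod p)}

/-!
The proof is the polynomial method of Hanson and Petridis (a variant of Stepanov's method). The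
`k`-th powers modulo `p` are `0` together with the subgroup of order `m = (p - 1) / k`, that is, the
roots of `X ^ (m + 1) = X`. If the first terms of the progression are all `k`-th powers, then,
after dividing by `b`, a sumset `A + B` of two intervals lies in the roots of
`X ^ (m + 1) = α X`, where `α = b ^ (-m)`.

Given `|A| = r + 1`, choose weights `w` on `A` such that `∑ a ∈ A, w a * P(a)` is the coefficient of
`X ^ r` in `P` whenever `deg P ≤ r` (Lagrange interpolation). The polynomial
`∑ a ∈ A, w a (X + a) ^ (m + r) - α` has degree exactly `m`, because the terms of higher degree
cancel and `(m + r).choose m` is nonzero modulo `p`; on the other hand it vanishes to order at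
least `r` at each point of `B`. Hence `r * |B| ≤ m` (`mul_card_le_of_sum_pow_eq`). The choice
`r = ⌊√m⌋` and `|B| = m / r + 1` contradicts this, so a non-residue occurs with
`n ≤ 2 * √m + 2`, which is better than the required bound.
-/

open Polynomial in
/-- The leading-coefficient functional on polynomials of degree at most `r` is a weighted sum of
the values at any `r + 1` points. -/
theorem exists_weights_sum_eq_coeff {F : Type*} [Field F] {A : Finset F} {r : ℕ}
    (hA : A.card = r + 1) :
    ∃ w : F → F, ∀ P : F[X], P.natDegree ≤ r → ∑ a ∈ A, w a * P.eval a = P.coeff r := by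
  classical
  refine ⟨fun a => (∏ j ∈ A.erase a, (a - j))⁻¹, fun P hP => ?_⟩
  have hdeg : P.degree < A.card := by
    rw [hA]
    exact (natDegree_le_iff_degree_le.1 hP).trans_lt (by exact_mod_cast Nat.lt_succ_self r)
  have h := Lagrange.coeff_eq_sum (s := A) (v := id) (Set.injOn_id _) hdeg
  rw [hA, Nat.add_sub_cancel] at h
  rw [h]
  exact Finset.sum_congr rfl fun a _ => by simp [div_eq_inv_mul]

open Polynomial in
/-- If all sums from `A + B` are roots of `X ^ (m + 1) = α X` (a coset of the group of `m`-th roots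
of unity together with `0`), then `(|A| - 1) * |B| ≤ m`. -/
theorem mul_card_le_of_sum_pow_eq {F : Type*} [Field F] {A B : Finset F} {r m : ℕ} (α : F)
    (hm : 0 < m) (hA : A.card = r + 1) (hchoose : ((m + r).choose m : F) ≠ 0)
    (h : ∀ a ∈ A, ∀ b ∈ B, (b + a) ^ (m + 1) = α * (b + a)) :
    r * B.card ≤ m := by
  classical
  obtain ⟨w, hw⟩ := exists_weights_sum_eq_coeff hA
  have hshift : ∀ (b : F) (j : ℕ), j ≤ r →
      ∑ a ∈ A, w a * (b + a) ^ j = if j = r then 1 else 0 := by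
    intro b j hj
    have h1 := hw ((X + C b) ^ j) (by simpa using hj)
    simp only [eval_pow, eval_add, eval_X, eval_C] at h1
    simp_rw [add_comm b, h1, coeff_X_add_C_pow]
    split_ifs with hjr
    · simp [hjr]
    · rw [Nat.choose_eq_zero_of_lt (by omega)]; simp
  set f : F[X] := ∑ a ∈ A, C (w a) * (X + C a) ^ (m + r) - C α with hf
  have hcoeff : ∀ n, m ≤ n → f.coeff n = if n = m then ((m + r).choose m : F) else 0 := by
    intro n hn
    have h0 : f.coeff n = (∑ a ∈ A, w a * (0 + a) ^ (m + r - n)) * ((m + r).choose n : F) := by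
      simp only [hf, coeff_sub, finsetSum_coeff, coeff_C_mul, coeff_X_add_C_pow, coeff_C,
        if_neg (show n ≠ 0 by omega), sub_zero, Finset.sum_mul, zero_add, mul_assoc]
    rw [h0, hshift 0 _ (by omega)]
    rcases eq_or_lt_of_le hn with rfl | hlt
    · simp
    · rw [if_neg hlt.ne']
      by_cases hnr : m + r < n
      · simp [Nat.choose_eq_zero_of_lt hnr]
      · rw [if_neg (by omega), zero_mul]
  have hdeg : f.natDegree ≤ m := by
    rw [natDegree_le_iff_coeff_eq_zero]
    intro n hn
    rw [hcoeff n hn.le, if_neg hn.ne']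
  have hf0 : f ≠ 0 := by
    intro h0
    apply hchoose
    have := hcoeff m le_rfl
    rwa [if_pos rfl, h0, coeff_zero, eq_comm] at this
  have hroot : ∀ b ∈ B, (X - C b) ^ r ∣ f := by
    intro b hb
    rw [X_sub_C_pow_dvd_iff, X_pow_dvd_iff]
    intro d hd
    have hcomp : f.comp (X + C b) = ∑ a ∈ A, C (w a) * (X + C (b + a)) ^ (m + r) - C α := by
      simp only [hf, sub_comp, Polynomial.sum_comp, mul_comp, C_comp, pow_comp, add_comp, X_comp,
        C_add, add_assoc]
    -- As `d < r`, one factor `(b + a) ^ (m + 1)` can be split off, which also covers `b + a = 0`.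
    have hsum : ∑ a ∈ A, w a * (b + a) ^ (m + r - d) = α * if r - d = r then 1 else 0 := by
      rw [← hshift b (r - d) (by omega), Finset.mul_sum]
      refine Finset.sum_congr rfl fun a ha => ?_
      rw [show m + r - d = (m + 1) + (r - d - 1) by omega, pow_add, h a ha b hb]
      obtain ⟨e, he⟩ : ∃ e, r - d = e + 1 := ⟨r - d - 1, by omega⟩
      rw [he, Nat.add_sub_cancel, pow_succ]
      ring
    rw [hcomp]
    simp only [coeff_sub, finsetSum_coeff, coeff_C_mul, coeff_X_add_C_pow, coeff_C, ← mul_assoc,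
      ← Finset.sum_mul]
    rw [hsum]
    rcases Nat.eq_zero_or_pos d with rfl | hd0
    · simp
    · simp [hd0.ne', show r - d ≠ r by omega]
  have hdvd : ∏ b ∈ B, (X - C b) ^ r ∣ f :=
    Finset.prod_dvd_of_coprime
      (fun a _ b _ hab => (pairwise_coprime_X_sub_C Function.injective_id hab).pow) hroot
  have hle := natDegree_le_of_dvd hdvd hf0
  rw [natDegree_prod _ _ fun b _ => pow_ne_zero _ (X_sub_C_ne_zero b)] at hle
  simp only [natDegree_pow, natDegree_X_sub_C, mul_one, Finset.sum_const, smul_eq_mul] at hle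
  rw [mul_comm]
  exact hle.trans hdeg

theorem injOn_natCast_add_range {p s : ℕ} (hs : s ≤ p) (x : ZMod p) :
    Set.InjOn (fun i : ℕ => x + (i : ZMod p)) (Finset.range s) := by
  intro i hi j hj hij
  simp only [Finset.coe_range, Set.mem_Iio] at hi hj
  have := (ZMod.natCast_eq_natCast_iff' i j p).1 (add_left_cancel hij)
  rwa [Nat.mod_eq_of_lt (by omega), Nat.mod_eq_of_lt (by omega)] at this

/-- A progression `β n + γ` modulo `p` meets the `k`-th power non-residues at some
`n ≤ 2 * √m + 2`, where `m = (p - 1) / k`. -/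
theorem exists_isPowerNonResidue_le {p k m : ℕ} (hp : p.Prime) (hk : 2 ≤ k) (hm : p - 1 = k * m)
    {β : ZMod p} (hβ : β ≠ 0) (γ : ZMod p) :
    ∃ n : ℕ, n ≤ 2 * Nat.sqrt m + 2 ∧ IsPowerNonResidue p k (β * n + γ) := by
  classical
  have : Fact p.Prime := ⟨hp⟩
  have hp2 := hp.two_le
  have hm0 : 0 < m := by
    rcases Nat.eq_zero_or_pos m with rfl | h
    · omega
    · exact h
  have h2m : 2 * m ≤ p - 1 := hm ▸ Nat.mul_le_mul_right m hk
  by_contra! hcon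
  set r := Nat.sqrt m with hr
  have hr0 : 0 < r := Nat.sqrt_pos.2 hm0
  have hrm : r ≤ m := Nat.sqrt_le_self m
  set s := m / r + 1 with hs
  have hrs : m < r * s := by
    exact Nat.lt_mul_div_succ m hr0
  have hsr : s ≤ r + 3 := by
    have h1 : m ≤ r * r + r + r := Nat.sqrt_le_add m
    have h2 : m / r ≤ r + 2 := by
      rw [Nat.div_le_iff_le_mul_add_pred hr0]
      nlinarith
    omega
  have hsp : s ≤ p := by
    have : m / r ≤ m := Nat.div_le_self _ _
    omega
  set A := (Finset.range (r + 1)).image fun i : ℕ => (0 : ZMod p) + i with hAdef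
  set B := (Finset.range s).image fun i : ℕ => γ / β + (i : ZMod p) with hBdef
  have hA : A.card = r + 1 := by
    rw [hAdef, Finset.card_image_of_injOn (injOn_natCast_add_range (by omega) _),
      Finset.card_range]
  have hB : B.card = s := by
    rw [hBdef, Finset.card_image_of_injOn (injOn_natCast_add_range hsp _), Finset.card_range]
  have hchoose : ((m + r).choose m : ZMod p) ≠ 0 := by
    rw [Ne, ZMod.natCast_eq_zero_iff]
    intro hdvd
    have h1 : p ∣ (m + r).factorial := by
      rw [← Nat.choose_mul_factorial_mul_factorial (Nat.le_add_right m r), mul_assoc]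
      exact hdvd.mul_right _
    have := (hp.dvd_factorial).1 h1
    omega
  have key := mul_card_le_of_sum_pow_eq (A := A) (B := B) (r := r) (β ^ m)⁻¹ hm0 hA hchoose ?_
  · rw [hB] at key
    omega
  intro a ha b hb
  rw [hAdef, Finset.mem_image] at ha
  rw [hBdef, Finset.mem_image] at hb
  obtain ⟨i, hi, rfl⟩ := ha
  obtain ⟨j, hj, rfl⟩ := hb
  rw [Finset.mem_range] at hi hj
  have hres := hcon (i + j) (by omega)
  rw [IsPowerNonResidue, not_not] at hres
  obtain ⟨y, hy⟩ := hres
  have hx : β * (γ / β + (j : ZMod p) + (0 + (i : ZMod p))) = y ^ k := by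
    rw [hy]; push_cast; field_simp; ring
  set x := γ / β + (j : ZMod p) + (0 + (i : ZMod p))
  have hpow : (y ^ k) ^ (m + 1) = y ^ k := by
    rw [← pow_mul, show k * (m + 1) = p + (k - 1) by rw [mul_add, ← hm]; omega, pow_add,
      ZMod.pow_card, ← pow_succ', show k - 1 + 1 = k by omega]
  rw [← hx, mul_pow, pow_succ β, mul_right_comm, mul_comm _ β] at hpow
  have h3 := mul_left_cancel₀ hβ hpow
  rw [eq_inv_mul_iff_mul_eq₀ (pow_ne_zero _ hβ)]
  exact h3

theorem theorem1 (p : ℕ) (hp : p.Prime) (k : ℕ) (hk : 2 ≤ k) (hkp : k ∣ p - 1)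
    (b : ℕ) (hb : ¬ p ∣ b) (c : ℤ) :
    ∃ v : ℤ, IsLeast (nonResiduesInAP p k b c) v ∧
      (v : ℝ) ≤ 7 / Real.sqrt 5 * (b : ℝ) * Real.sqrt (((p : ℝ) - 1) / (k : ℝ))
        + 4 * (b : ℝ) + (c : ℝ) := by
  classical
  obtain ⟨m, hm⟩ := hkp
  have hβ : (b : ZMod p) ≠ 0 := by rwa [Ne, ZMod.natCast_eq_zero_iff]
  obtain ⟨n, hn, hres⟩ := exists_isPowerNonResidue_le hp hk hm hβ (c : ZMod p)
  have hex : ∃ n : ℕ, IsPowerNonResidue p k ((b : ZMod p) * n + c) := ⟨n, hres⟩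
  refine ⟨b * (Nat.find hex : ℕ) + c, ⟨⟨Nat.find hex, rfl, ?_⟩, ?_⟩, ?_⟩
  · simpa using Nat.find_spec hex
  · rintro _ ⟨l, rfl, hl⟩
    have : Nat.find hex ≤ l := Nat.find_min' hex (by simpa using hl)
    gcongr
  · have hfind : (Nat.find hex : ℝ) ≤ 2 * (Nat.sqrt m : ℝ) + 2 := by
      exact_mod_cast (Nat.find_min' hex hres).trans hn
    have hquot : ((p : ℝ) - 1) / k = m := by
      have hk0 : (k : ℝ) ≠ 0 := by positivity
      rw [div_eq_iff hk0, mul_comm, ← Nat.cast_one, ← Nat.cast_sub hp.one_lt.le, hm, Nat.cast_mul]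
    have hsqrt : (Nat.sqrt m : ℝ) ≤ √(m : ℝ) := Real.nat_sqrt_le_real_sqrt
    have hconst : (2 : ℝ) ≤ 7 / √5 := by
      rw [le_div_iff₀ (by positivity)]
      have : √(5 : ℝ) ≤ 3 := Real.sqrt_le_iff.2 (by norm_num)
      linarith
    have hmul : 2 * √(m : ℝ) ≤ 7 / √5 * √(m : ℝ) := by gcongr
    rw [hquot]
    push_cast
    have : (b : ℝ) * (Nat.find hex : ℝ) ≤ b * (7 / √5 * √(m : ℝ) + 4) := by
      gcongr
      linarith
    linarith
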